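/- An \emph{ai-semiring} is a nonempty set $S$ with two binary operations $+,\cdot$ such that $+$ is associative, commutative and idempotent, $\cdot$ is associative, and $\cdot$ distributes over $+$ on both sides (no constants are part of the signature). A \emph{variety} is a class of ai-semirings closed under homomorphic images, subalgebras and direct products; $\mathbf{V}(S)$ denotes the smallest variety containing $S$. Let $\mathbb{H}=(V,E)$ be a finite $3$-uniform hypergraph without isolated vertices that is linear, i.e. any two distinct hyperedges share at most one vertex. A \emph{subhyperedge} is a subset of a hyperedge; two subhyperedges are \emph{linked} if a single vertex lying outside both completes each of them to a hyperedge. The \emph{hypergraph semigroup} of $\mathbb{H}$ is the semigroup generated by $0$ and the elements $\mathbf{a}_v$ $(v\in V)$ subject to the relations \begin{itemize} \item $00=0\mathbf{a}_u=\mathbf{a}_u0=0$ and $\mathbf{a}_u\mathbf{a}_v=\mathbf{a}_v\mathbf{a}_u$ for all $u,v\in V$; \item $\mathbf{a}_u\mathbf{a}_v\mathbf{a}_w=\mathbf{a}_{u'}\mathbf{a}_{v'}\mathbf{a}_{w'}$ whenever $\{u,v,w\},\{u',v',w'\}\in E$; \item $\mathbf{a}_u\mathbf{a}_v\mathbf{a}_w=0$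 whenever $\{u,v,w\}\notin E$; \item $\mathbf{a}_u\mathbf{a}_v=0$ whenever $u=v$ or $\{u,v\}$ is not a subhyperedge; \item $\mathbf{a}_u\mathbf{a}_v=\mathbf{a}_{u'}\mathbf{a}_{v'}$ whenever $\{u,v\}$ and $\{u',v'\}$ are linked. \end{itemize} With the addition $x+x=x$ and $x+y=0$ for $x\ne y$ it becomes an ai-semiring, the \emph{hypergraph semiring} $S_{\mathbb{H}}$. Let $\mathbb{B}_1$ be the triangle, the hypergraph with vertices $0,\dots,5$ and hyperedges $\{0,1,2\},\{2,3,4\},\{4,5,0\}$. For $i\ge 1$ let $\mathbb{F}_i$ be the $i$-th fan, the hypergraph with the $3i+3$ distinct vertices $c$, $r_0,\dots,r_i$, $m_0,\dots,m_i$, $n_0,\dots,n_{i-1}$ and the $2i+1$ hyperedges $\{c,m_j,r_j\}$ $(0\le j\le i)$ and $\{r_j,n_j,r_{j+1}\}$ $(0\le j<i)$. \textbf{Proposition.} For all $i\ge 1$, $\mathbf{V}(S_{\mathbb{F}_i})=\mathbf{V}(S_{\mathbb{B}_1})$. -/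

import Mathlib

universe u v

/-! ### Additively idempotent semirings and varieties -/

/-- An ai-semiring: two binary operations, no constants, such that `+` is a commutative idempotent
semigroup operation, `*` is associative, and `*` distributes over `+` on both sides. -/
class AiSemiring (S : Type u) extends AddCommSemigroup S, Semigroup S, Distrib S where
  add_self : ∀ a : S, a + a = a

/-- A (nonempty) ai-semiring, bundled with its carrier. -/
structure AiSemiringAlg : Type (u + 1) where
  carrier : Type u
  [str : AiSemiring carrier]
  [nonempty : Nonempty carrier]

attribute [instance] AiSemiringAlg.str AiSemiringAlg.nonempty

/-- Semiring homomorphisms: maps that preserve `+` and `*`. -/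
def IsSemiringHom {A : Type u} {B : Type v} [AiSemiring A] [AiSemiring B] (f : A → B) : Prop :=
  (∀ x y, f (x + y) = f x + f y) ∧ (∀ x y, f (x * y) = f x * f y)

/-- The direct product of a family of ai-semirings, with the coordinatewise operations. -/
instance AiSemiring.pi {I : Type v} (A : I → Type u) [∀ i, AiSemiring (A i)] :
    AiSemiring (∀ i, A i) where
  add_assoc a b c := by funext i; exact add_assoc _ _ _
  add_comm a b := by funext i; exact add_comm _ _
  mul_assoc a b c := by funext i; exact mul_assoc _ _ _
  left_distrib a b c := by funext i; exact left_distrib _ _ _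
  right_distrib a b c := by funext i; exact right_distrib _ _ _
  add_self a := by funext i; exact AiSemiring.add_self _

/-- A class of ai-semirings is a variety when it is closed under homomorphic images, subalgebras
(up to isomorphism) and direct products. -/
structure IsVariety (K : Set AiSemiringAlg.{u}) : Prop where
  image : ∀ A ∈ K, ∀ (B : AiSemiringAlg.{u}) (f : A.carrier → B.carrier),
    IsSemiringHom f → Function.Surjective f → B ∈ K
  sub : ∀ A ∈ K, ∀ (B : AiSemiringAlg.{u}) (f : B.carrier → A.carrier),
    IsSemiringHom f → Function.Injective f → B ∈ K
  prod : ∀ (I : Type u) (A : I → AiSemiringAlg.{u}), (∀ i, A i ∈ K) →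
    (⟨∀ i, (A i).carrier⟩ : AiSemiringAlg.{u}) ∈ K

/-- `𝐕(S)`: the smallest variety that contains `S`, that is, the intersection of all varieties
containing `S`. (Varieties are closed under isomorphism; the isomorphic copies serve only to regard
`S` as an ai-semiring in a larger universe.) -/
def generatedVariety (S : AiSemiringAlg.{v}) : Set AiSemiringAlg.{max u v} :=
  {T | ∀ K : Set AiSemiringAlg.{max u v}, IsVariety K →
    (∀ S' : AiSemiringAlg.{max u v}, (∃ f : S'.carrier → S.carrier,
      IsSemiringHom f ∧ Function.Bijective f) → S' ∈ K) → T ∈ K}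

/-! ### 3-uniform hypergraphs, their semigroups and semirings -/

/-- A finite linear 3-uniform hypergraph with vertex set the whole type `V` and without isolated
vertices. -/
structure ThreeHypergraph (V : Type u) extends Hypergraph V where
  finite : Finite V
  vertexSet_eq : vertexSet = Set.univ
  uniform : ∀ e ∈ edgeSet, e.ncard = 3
  linear : ∀ e ∈ edgeSet, ∀ f ∈ edgeSet, e ≠ f → (e ∩ f).Subsingleton
  no_isolated : ∀ x : V, ¬ toHypergraph.IsIsolated x

/-- The generating letters of the hypergraph semigroup: `0` and one letter per vertex. -/
inductive Letter (V : Type u) : Type u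
  | zero : Letter V
  | vert : V → Letter V

namespace ThreeHypergraph

variable {V : Type u} (H : ThreeHypergraph V)

/-- A set of vertices is a subhyperedge when it is contained in a hyperedge. -/
def IsSubedge (s : Set V) : Prop := ∃ e ∈ H.edgeSet, s ⊆ e

/-- Two sets of vertices are linked when one vertex, outside both, completes both of them to
hyperedges (so that they are subhyperedges). -/
def Linked (s t : Set V) : Prop :=
  ∃ w, w ∉ s ∧ w ∉ t ∧ insert w s ∈ H.edgeSet ∧ insert w t ∈ H.edgeSet

/-- The one-letter word `0`. -/
def wz : FreeSemigroup (Letter V) := FreeSemigroup.of Letter.zero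

/-- The one-letter word `𝐚_x`. -/
def wa (x : V) : FreeSemigroup (Letter V) := FreeSemigroup.of (Letter.vert x)

/-- The defining relations of the hypergraph semigroup. The relations `edge` say that all words
`𝐚_x 𝐚_y 𝐚_z` with `{x, y, z}` a hyperedge represent one and the same element `𝐚`. -/
inductive Rel : FreeSemigroup (Letter V) → FreeSemigroup (Letter V) → Prop
  | comm (x y : V) : Rel (wa x * wa y) (wa y * wa x)
  | edge (x y z x' y' z' : V) (h : {x, y, z} ∈ H.edgeSet) (h' : {x', y', z'} ∈ H.edgeSet) :
      Rel (wa x * wa y * wa z) (wa x' * wa y' * wa z')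
  | nonedge (x y z : V) (h : {x, y, z} ∉ H.edgeSet) : Rel (wa x * wa y * wa z) wz
  | nonsub (x y : V) (h : x = y ∨ ¬ H.IsSubedge {x, y}) : Rel (wa x * wa y) wz
  | zero_left (x : V) : Rel (wz * wa x) wz
  | zero_right (x : V) : Rel (wa x * wz) wz
  | zero_zero : Rel (wz * wz) wz
  | linked (x y x' y' : V) (h : H.Linked {x, y} {x', y'}) : Rel (wa x * wa y) (wa x' * wa y')

/-- The hypergraph semigroup: the free semigroup on the letters modulo the congruence generated by
the defining relations. -/
def SG : Type u := (conGen H.Rel).Quotient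

instance : Semigroup H.SG := inferInstanceAs (Semigroup (conGen H.Rel).Quotient)

/-- The element of the hypergraph semigroup represented by a word. -/
def cls (w : FreeSemigroup (Letter V)) : H.SG := (w : (conGen H.Rel).Quotient)

/-- The zero element of the hypergraph semigroup. -/
def zeroElt : H.SG := H.cls wz

/-- The generator of the hypergraph semigroup that belongs to the vertex `x`. -/
def gen (x : V) : H.SG := H.cls (wa x)

open Classical in
/-- Flat addition: `a + a = a`, and `a + b = 0` for distinct `a`, `b`. -/
noncomputable instance : Add H.SG := ⟨fun a b => if a = b then a else H.zeroElt⟩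

/-! The remaining facts show that the hypergraph semigroup is 0-cancellative, so that flat addition
makes it an ai-semiring. -/

theorem cls_eq {a b : FreeSemigroup (Letter V)} (h : H.Rel a b) : H.cls a = H.cls b :=
  (Con.eq _).2 (ConGen.Rel.of _ _ h)

theorem sg_induction {P : H.SG → Prop} (q : H.SG) (h0 : P H.zeroElt) (h1 : ∀ x, P (H.gen x))
    (hm : ∀ a b, P a → P b → P (a * b)) : P q := by
  obtain ⟨w, rfl⟩ : ∃ w, H.cls w = q := Con.induction_on q fun w => ⟨w, rfl⟩
  have hl : ∀ l : Letter V, P (H.cls (FreeSemigroup.of l)) := fun l => by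
    cases l with
    | zero => exact h0
    | vert x => exact h1 x
  induction w using FreeSemigroup.recOnMul with
  | ih1 l => exact hl l
  | ih2 l w _ ih => exact hm _ _ (hl l) ih

theorem sg_zero_mul (q : H.SG) : H.zeroElt * q = H.zeroElt := by
  refine H.sg_induction (P := fun q => H.zeroElt * q = H.zeroElt) q
    (H.cls_eq .zero_zero) (fun x => H.cls_eq (.zero_left x)) ?_
  intro a b ha hb
  rw [← mul_assoc, ha, hb]

theorem sg_mul_zero (q : H.SG) : q * H.zeroElt = H.zeroElt := by
  refine H.sg_induction (P := fun q => q * H.zeroElt = H.zeroElt) q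
    (H.cls_eq .zero_zero) (fun x => H.cls_eq (.zero_right x)) ?_
  intro a b ha hb
  rw [mul_assoc, hb, ha]

theorem edge_distinct {x y z : V} (h : {x, y, z} ∈ H.edgeSet) : x ≠ y ∧ x ≠ z ∧ y ≠ z := by
  have h3 := H.uniform _ h
  have h2 : ∀ a b : V, ({a, b} : Set V).ncard ≤ 2 := fun a b =>
    (Set.ncard_insert_le a {b}).trans (by simp)
  refine ⟨?_, ?_, ?_⟩
  · rintro rfl
    have := h2 x z
    simp only [Set.mem_insert_iff, true_or, Set.insert_eq_of_mem] at h3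
    omega
  · rintro rfl
    have := h2 y x
    simp only [Set.mem_insert_iff, Set.mem_singleton_iff, or_true, Set.insert_eq_of_mem] at h3
    omega
  · rintro rfl
    have := h2 x y
    simp only [Set.mem_singleton_iff, Set.insert_eq_of_mem] at h3
    omega

theorem edge_swap {x y z : V} : ({x, y, z} : Set V) ∈ H.edgeSet ↔ {y, x, z} ∈ H.edgeSet := by
  rw [Set.insert_comm]

theorem edge_rot {x y z : V} : ({x, y, z} : Set V) ∈ H.edgeSet ↔ {y, z, x} ∈ H.edgeSet := by
  rw [show ({x, y, z} : Set V) = {y, z, x} by ext; simp; tauto]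

theorem edge_unique {x y z w : V} (h : {x, y, z} ∈ H.edgeSet) (h' : {x, y, w} ∈ H.edgeSet) :
    z = w := by
  obtain ⟨hxy, hxz, hyz⟩ := H.edge_distinct h
  have he : ({x, y, z} : Set V) = {x, y, w} := by
    by_contra hne
    exact hxy (H.linear _ h _ h' hne (by simp) (by simp))
  have hz : z ∈ ({x, y, w} : Set V) := he ▸ (by simp)
  simp only [Set.mem_insert_iff, Set.mem_singleton_iff] at hz
  rcases hz with hz | hz | hz
  · exact absurd hz.symm hxz
  · exact absurd hz.symm hyz
  · exact hz

theorem exists_completion {x y : V} (hxy : x ≠ y) (h : H.IsSubedge {x, y}) :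
    ∃ w, {x, y, w} ∈ H.edgeSet := by
  obtain ⟨e, he, hs⟩ := h
  obtain ⟨a, b, c, -, -, -, rfl⟩ := Set.ncard_eq_three.1 (H.uniform e he)
  have hx : x ∈ ({a, b, c} : Set V) := hs (by simp)
  have hy : y ∈ ({a, b, c} : Set V) := hs (by simp)
  simp only [Set.mem_insert_iff, Set.mem_singleton_iff] at hx hy
  rcases hx with rfl | rfl | rfl <;> rcases hy with rfl | rfl | rfl
  all_goals first
    | exact absurd rfl hxy
    | exact ⟨_, he⟩
    | exact ⟨_, H.edge_rot.1 he⟩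
    | exact ⟨_, H.edge_rot.2 he⟩
    | exact ⟨_, H.edge_swap.1 he⟩
    | exact ⟨_, H.edge_swap.1 (H.edge_rot.1 he)⟩
    | exact ⟨_, H.edge_swap.1 (H.edge_rot.2 he)⟩

theorem gen_mul_comm (x y : V) : H.gen x * H.gen y = H.gen y * H.gen x := H.cls_eq (.comm x y)

theorem gen_mul_self (x : V) : H.gen x * H.gen x = H.zeroElt := H.cls_eq (.nonsub x x (.inl rfl))

theorem gen_mul_eq_zero {x y : V} (h : ¬ ∃ w, {x, y, w} ∈ H.edgeSet) :
    H.gen x * H.gen y = H.zeroElt :=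
  H.cls_eq (.nonsub x y (by
    by_cases hxy : x = y
    · exact .inl hxy
    · exact .inr fun hs => h (H.exists_completion hxy hs)))

theorem gen_mul_eq {x y x' y' w : V} (h : {x, y, w} ∈ H.edgeSet) (h' : {x', y', w} ∈ H.edgeSet) :
    H.gen x * H.gen y = H.gen x' * H.gen y' := by
  obtain ⟨-, h1, h2⟩ := H.edge_distinct h
  obtain ⟨-, h3, h4⟩ := H.edge_distinct h'
  refine H.cls_eq (.linked x y x' y' ⟨w, ?_, ?_, ?_, ?_⟩)
  · simp [h1.symm, h2.symm]
  · simp [h3.symm, h4.symm]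
  · rwa [← edge_rot] at h
  · rwa [← edge_rot] at h'

theorem gen_mul_three {x y z x' y' z' : V} (h : {x, y, z} ∈ H.edgeSet)
    (h' : {x', y', z'} ∈ H.edgeSet) :
    H.gen x * H.gen y * H.gen z = H.gen x' * H.gen y' * H.gen z' :=
  H.cls_eq (.edge x y z x' y' z' h h')

theorem gen_mul_three_zero {x y z : V} (h : {x, y, z} ∉ H.edgeSet) :
    H.gen x * H.gen y * H.gen z = H.zeroElt :=
  H.cls_eq (.nonedge x y z h)

theorem gen_mul_four (x y z t : V) :
    H.gen x * H.gen y * H.gen z * H.gen t = H.zeroElt := by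
  by_cases h : ({x, y, z} : Set V) ∈ H.edgeSet
  · by_cases h' : ({x, y, t} : Set V) ∈ H.edgeSet
    · obtain rfl := H.edge_unique h h'
      rw [mul_assoc, gen_mul_self, sg_mul_zero]
    · rw [mul_assoc, H.gen_mul_comm z t, ← mul_assoc, H.gen_mul_three_zero h', sg_zero_mul]
  · rw [H.gen_mul_three_zero h, sg_zero_mul]

/-- Normal forms of the elements of the hypergraph semigroup: `0`, the generators, the products of
two generators (determined by the vertex that completes them to a hyperedge), and `𝐚`. -/
inductive NF (H : ThreeHypergraph V) : Type u
  | zero : NF H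
  | one : V → NF H
  | two : V → NF H
  | top : NF H

open Classical in
/-- Multiplication of normal forms. -/
noncomputable def nfMul : H.NF → H.NF → H.NF
  | .one x, .one y => if h : ∃ w, {x, y, w} ∈ H.edgeSet then .two h.choose else .zero
  | .one x, .two w => if x = w then .top else .zero
  | .two w, .one x => if x = w then .top else .zero
  | _, _ => .zero

theorem nfMul_one_one {x y w : V} (h : {x, y, w} ∈ H.edgeSet) :
    H.nfMul (.one x) (.one y) = .two w := by
  have h' : ∃ w, ({x, y, w} : Set V) ∈ H.edgeSet := ⟨w, h⟩
  simp only [nfMul, h', dite_true]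
  rw [H.edge_unique h'.choose_spec h]

theorem nfMul_one_one_zero {x y : V} (h : ¬ ∃ w, {x, y, w} ∈ H.edgeSet) :
    H.nfMul (.one x) (.one y) = .zero := by
  simp only [nfMul, h, dite_false]

theorem nfMul_comm (a b : H.NF) : H.nfMul a b = H.nfMul b a := by
  cases a <;> cases b <;> try rfl
  rename_i x y
  by_cases h : ∃ w, ({x, y, w} : Set V) ∈ H.edgeSet
  · obtain ⟨w, h⟩ := h
    rw [H.nfMul_one_one h, H.nfMul_one_one (H.edge_swap.1 h)]
  · rw [H.nfMul_one_one_zero h, H.nfMul_one_one_zero]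
    rintro ⟨w, h'⟩
    exact h ⟨w, H.edge_swap.1 h'⟩

open Classical in
theorem nfMul_three (x y z : V) : H.nfMul (H.nfMul (.one x) (.one y)) (.one z) =
    if {x, y, z} ∈ H.edgeSet then .top else .zero := by
  by_cases h : ∃ w, ({x, y, w} : Set V) ∈ H.edgeSet
  · obtain ⟨w, h⟩ := h
    rw [H.nfMul_one_one h]
    by_cases hz : z = w
    · subst hz
      simp [nfMul, h]
    · rw [if_neg fun h' => hz (H.edge_unique h' h)]
      simp [nfMul, hz]
  · rw [H.nfMul_one_one_zero h, if_neg fun h' => h ⟨z, h'⟩]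
    rfl

theorem nfMul_one_one_ne (x y z : V) : H.nfMul (.one x) (.one y) ≠ .one z ∧
    H.nfMul (.one x) (.one y) ≠ .top := by
  by_cases h : ∃ w, ({x, y, w} : Set V) ∈ H.edgeSet
  · obtain ⟨w, h⟩ := h
    simp [H.nfMul_one_one h]
  · simp [H.nfMul_one_one_zero h]

theorem nfMul_two_left (x y w : V) : H.nfMul (H.nfMul (.one x) (.one y)) (.two w) = .zero := by
  have := H.nfMul_one_one_ne x y
  cases h : H.nfMul (.one x) (.one y) <;> simp_all [nfMul]

theorem nfMul_top_left (a : H.NF) : H.nfMul .top a = .zero := by cases a <;> rfl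

theorem nfMul_zero_left (a : H.NF) : H.nfMul .zero a = .zero := by cases a <;> rfl

theorem nfMul_two_one_left (x w : V) (a : H.NF) :
    H.nfMul (H.nfMul (.one x) (.two w)) a = .zero := by
  by_cases h : x = w
  · simp [nfMul, h]
  · simp [nfMul, h]

theorem nfMul_assoc (a b c : H.NF) :
    H.nfMul (H.nfMul a b) c = H.nfMul a (H.nfMul b c) := by
  have hz : ∀ a : H.NF, H.nfMul a .zero = .zero := fun a => by cases a <;> rfl
  have ht : ∀ a : H.NF, H.nfMul a .top = .zero := fun a => by cases a <;> rfl
  have h22 : ∀ x y : V, H.nfMul (.two x) (.two y) = .zero := fun _ _ => rfl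
  cases a with
  | zero => simp [nfMul_zero_left]
  | top => simp [nfMul_zero_left, nfMul_top_left]
  | two w =>
    cases b with
    | zero => simp [nfMul_zero_left, hz]
    | top => simp [nfMul_zero_left, nfMul_top_left, hz, ht]
    | two x =>
      rw [h22, nfMul_zero_left, nfMul_comm]
      cases c with
      | one y => rw [H.nfMul_comm (.two x), nfMul_two_one_left]
      | _ => rfl
    | one x =>
      rw [H.nfMul_comm (.two w), nfMul_two_one_left, nfMul_comm]
      cases c with
      | one y => rw [nfMul_two_left]
      | two y => rw [nfMul_two_one_left]
      | _ => rfl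
  | one w =>
    cases b with
    | zero => simp [nfMul_zero_left, hz]
    | top => simp [nfMul_zero_left, nfMul_top_left, hz, ht]
    | two x =>
      rw [nfMul_two_one_left, nfMul_comm]
      cases c with
      | one y => rw [H.nfMul_comm (.two x), nfMul_two_one_left]
      | _ => rfl
    | one x =>
      cases c with
      | zero => simp [hz]
      | top => simp [hz, ht]
      | two y => rw [nfMul_two_left, H.nfMul_comm (.one w), nfMul_two_one_left]
      | one y =>
        rw [nfMul_three, H.nfMul_comm (.one w), nfMul_three]
        by_cases h : ({w, x, y} : Set V) ∈ H.edgeSet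
        · rw [if_pos h, if_pos (H.edge_rot.1 h)]
        · rw [if_neg h, if_neg fun h' => h (H.edge_rot.2 h')]

noncomputable instance : Semigroup H.NF where
  mul := H.nfMul
  mul_assoc := H.nfMul_assoc

theorem nf_cancel {a b c : H.NF} (h : a * b = a * c) (h0 : a * b ≠ .zero) : b = c := by
  change H.nfMul a b = H.nfMul a c at h
  change H.nfMul a b ≠ .zero at h0
  cases a with
  | zero => exact absurd (nfMul_zero_left _ _) h0
  | top => exact absurd (nfMul_top_left _ _) h0
  | two w =>
    cases b with
    | one x =>
      cases c with
      | one y =>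
        by_cases hx : x = w <;> by_cases hy : y = w <;> simp_all [nfMul]
      | _ => exact absurd h h0
    | _ => exact absurd rfl h0
  | one w =>
    cases b with
    | zero => exact absurd rfl h0
    | top => exact absurd rfl h0
    | two x =>
      cases c with
      | zero => exact absurd h h0
      | top => exact absurd h h0
      | two y => by_cases hx : w = x <;> by_cases hy : w = y <;> simp_all [nfMul]
      | one y =>
        have hne := (H.nfMul_one_one_ne w y w).2
        by_cases hx : w = x
        · exact absurd (h.symm.trans (by simp [nfMul, hx])) hne
        · exact absurd (by simp [nfMul, hx]) h0
    | one x =>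
      have hx : ∃ t, ({w, x, t} : Set V) ∈ H.edgeSet := by
        by_contra hx
        exact h0 (H.nfMul_one_one_zero hx)
      obtain ⟨t, hx⟩ := hx
      rw [H.nfMul_one_one hx] at h
      cases c with
      | zero => exact absurd h (by simp [nfMul])
      | top => exact absurd h (by simp [nfMul])
      | two y => by_cases hy : w = y <;> simp [nfMul, hy] at h
      | one y =>
        have hy : ∃ t, ({w, y, t} : Set V) ∈ H.edgeSet := by
          by_contra hy
          simp [H.nfMul_one_one_zero hy] at h
        obtain ⟨s, hy⟩ := hy
        rw [H.nfMul_one_one hy] at h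
        obtain rfl : t = s := by simpa using h
        rw [H.edge_unique (H.edge_rot.2 hx) (H.edge_rot.2 hy)]

/-- The normal form of a word. -/
noncomputable def wordNF : FreeSemigroup (Letter V) →ₙ* H.NF :=
  FreeSemigroup.lift fun l => match l with
    | .zero => .zero
    | .vert x => .one x

theorem wordNF_rel {a b : FreeSemigroup (Letter V)} (h : H.Rel a b) :
    H.wordNF a = H.wordNF b := by
  have ha : ∀ x, H.wordNF (wa x) = .one x := fun x => rfl
  have hz : H.wordNF wz = .zero := rfl
  have hm : ∀ p q : H.NF, p * q = H.nfMul p q := fun _ _ => rfl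
  cases h with
  | comm x y => simp only [map_mul, ha, hm]; exact H.nfMul_comm _ _
  | edge x y z x' y' z' h h' => simp only [map_mul, ha, hm, nfMul_three, h, h', if_true]
  | nonedge x y z h => simp only [map_mul, ha, hm, nfMul_three, h, if_false, hz]
  | nonsub x y h =>
    simp only [map_mul, ha, hm, hz]
    refine H.nfMul_one_one_zero ?_
    rintro ⟨w, hw⟩
    rcases h with h | h
    · exact (H.edge_distinct hw).1 h
    · exact h ⟨_, hw, by intro t; simp; tauto⟩
  | zero_left x => rfl
  | zero_right x => rfl
  | zero_zero => rfl
  | linked x y x' y' h =>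
    obtain ⟨w, -, -, h, h'⟩ := h
    simp only [map_mul, ha, hm]
    rw [H.nfMul_one_one (H.edge_rot.1 h), H.nfMul_one_one (H.edge_rot.1 h')]

/-- The normal form of an element of the hypergraph semigroup. -/
noncomputable def toNF : H.SG →ₙ* H.NF where
  toFun := fun q => Quotient.liftOn q (fun w => H.wordNF w) fun a b h => by
    have h' : ConGen.Rel H.Rel a b := h
    clear h
    induction h' with
    | of _ _ h => exact H.wordNF_rel h
    | refl => rfl
    | symm _ ih => exact ih.symm
    | trans _ _ ih ih' => exact ih.trans ih'
    | mul _ _ ih ih' => simp only [map_mul] at *; rw [ih, ih']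
  map_mul' a b := Con.induction_on₂ a b fun a b => map_mul H.wordNF a b

open Classical in
/-- The element of the hypergraph semigroup with a given normal form. -/
noncomputable def ofNF : H.NF → H.SG
  | .zero => H.zeroElt
  | .one x => H.gen x
  | .two w => if h : ∃ p : V × V, {p.1, p.2, w} ∈ H.edgeSet then
      H.gen h.choose.1 * H.gen h.choose.2 else H.zeroElt
  | .top => if h : ∃ p : V × V × V, {p.1, p.2.1, p.2.2} ∈ H.edgeSet then
      H.gen h.choose.1 * H.gen h.choose.2.1 * H.gen h.choose.2.2 else H.zeroElt

theorem ofNF_two {x y w : V} (h : {x, y, w} ∈ H.edgeSet) :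
    H.ofNF (.two w) = H.gen x * H.gen y := by
  have h' : ∃ p : V × V, {p.1, p.2, w} ∈ H.edgeSet := ⟨(x, y), h⟩
  simp only [ofNF, h', dite_true]
  exact H.gen_mul_eq h'.choose_spec h

theorem ofNF_top {x y z : V} (h : {x, y, z} ∈ H.edgeSet) :
    H.ofNF .top = H.gen x * H.gen y * H.gen z := by
  have h' : ∃ p : V × V × V, {p.1, p.2.1, p.2.2} ∈ H.edgeSet := ⟨(x, y, z), h⟩
  simp only [ofNF, h', dite_true]
  exact H.gen_mul_three h'.choose_spec h

theorem ofNF_two_cases (w : V) :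
    ∃ x y, {x, y, w} ∈ H.edgeSet ∧ H.ofNF (.two w) = H.gen x * H.gen y := by
  have hw := H.no_isolated w
  simp only [Hypergraph.IsIsolated, not_forall, not_not] at hw
  obtain ⟨e, he, hw⟩ := hw
  obtain ⟨a, b, c, -, -, -, rfl⟩ := Set.ncard_eq_three.1 (H.uniform e he)
  simp only [Set.mem_insert_iff, Set.mem_singleton_iff] at hw
  rcases hw with rfl | rfl | rfl
  · exact ⟨b, c, H.edge_rot.1 he, H.ofNF_two (H.edge_rot.1 he)⟩
  · exact ⟨c, a, H.edge_rot.1 (H.edge_rot.1 he), H.ofNF_two (H.edge_rot.1 (H.edge_rot.1 he))⟩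
  · exact ⟨a, b, he, H.ofNF_two he⟩

theorem gen_mul_ofNF (x : V) (a : H.NF) :
    H.gen x * H.ofNF a = H.ofNF (H.nfMul (.one x) a) := by
  cases a with
  | zero => exact H.sg_mul_zero _
  | one y =>
    by_cases h : ∃ w, ({x, y, w} : Set V) ∈ H.edgeSet
    · obtain ⟨w, h⟩ := h
      rw [H.nfMul_one_one h, H.ofNF_two h]
      rfl
    · rw [H.nfMul_one_one_zero h]
      exact H.gen_mul_eq_zero h
  | two w =>
    obtain ⟨p, q, h, he⟩ := H.ofNF_two_cases w
    rw [he, ← mul_assoc]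
    by_cases hx : x = w
    · subst hx
      have h' := H.edge_rot.2 h
      simp only [nfMul, if_true]
      rw [H.ofNF_top h']
    · simp only [nfMul, hx, if_false]
      exact H.gen_mul_three_zero fun h' => hx (H.edge_unique (H.edge_rot.1 h') h)
  | top =>
    change _ = H.zeroElt
    by_cases h : ∃ p : V × V × V, {p.1, p.2.1, p.2.2} ∈ H.edgeSet
    · obtain ⟨p, h⟩ := h
      rw [H.ofNF_top h, ← mul_assoc, ← mul_assoc, gen_mul_four]
    · simp only [ofNF, h, dite_false, sg_mul_zero]

theorem ofNF_mul_ofNF (q : H.SG) (a : H.NF) : q * H.ofNF a = H.ofNF (H.toNF q * a) := by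
  revert a
  refine H.sg_induction (P := fun q => ∀ a, q * H.ofNF a = H.ofNF (H.toNF q * a)) q ?_ ?_ ?_
  · intro a
    rw [sg_zero_mul, show H.toNF H.zeroElt * a = .zero from H.nfMul_zero_left a]
    rfl
  · exact H.gen_mul_ofNF
  · intro p r hp hr a
    rw [mul_assoc, hr, hp, map_mul, mul_assoc]

theorem ofNF_toNF (q : H.SG) : H.ofNF (H.toNF q) = q := by
  refine H.sg_induction (P := fun q => H.ofNF (H.toNF q) = q) q rfl (fun _ => rfl) ?_
  intro a b _ hb
  rw [map_mul, ← ofNF_mul_ofNF, hb]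

theorem toNF_injective : Function.Injective H.toNF :=
  Function.LeftInverse.injective H.ofNF_toNF

theorem sg_mul_comm (a b : H.SG) : a * b = b * a :=
  H.toNF_injective (by rw [map_mul, map_mul]; exact H.nfMul_comm _ _)

/-- The hypergraph semigroup is 0-cancellative. -/
theorem sg_cancel {a b c : H.SG} (h : a * b = a * c) (h0 : a * b ≠ H.zeroElt) : b = c := by
  apply H.toNF_injective
  apply H.nf_cancel (a := H.toNF a)
  · rw [← map_mul, ← map_mul, h]
  · rw [← map_mul]
    intro h'
    exact h0 (H.toNF_injective h')

theorem add_def (a b : H.SG) : (a = b → a + b = a) ∧ (a ≠ b → a + b = H.zeroElt) :=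
  ⟨fun h => if_pos h, fun h => if_neg h⟩

theorem sg_add_self (a : H.SG) : a + a = a := (H.add_def a a).1 rfl

theorem sg_add_zero (a : H.SG) : a + H.zeroElt = H.zeroElt := by
  by_cases h : a = H.zeroElt
  · rw [h, sg_add_self]
  · exact (H.add_def _ _).2 h

theorem sg_add_comm (a b : H.SG) : a + b = b + a := by
  by_cases h : a = b
  · rw [h]
  · rw [(H.add_def a b).2 h, (H.add_def b a).2 (Ne.symm h)]

theorem sg_add_assoc (a b c : H.SG) : a + b + c = a + (b + c) := by
  by_cases hab : a = b
  · subst hab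
    by_cases hc : a = c
    · subst hc; simp only [sg_add_self]
    · rw [sg_add_self, (H.add_def a c).2 hc, sg_add_zero]
  · rw [(H.add_def a b).2 hab, H.sg_add_comm _ c, sg_add_zero]
    by_cases hc : b = c
    · subst hc; rw [sg_add_self, (H.add_def a b).2 hab]
    · rw [(H.add_def b c).2 hc, sg_add_zero]

theorem sg_mul_add (a b c : H.SG) : a * (b + c) = a * b + a * c := by
  by_cases hbc : b = c
  · subst hbc; simp only [sg_add_self]
  · rw [(H.add_def b c).2 hbc, sg_mul_zero]
    by_cases h : a * b = a * c
    · rw [h, sg_add_self]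
      by_contra h0
      exact hbc (H.sg_cancel h (by rw [h]; exact Ne.symm h0))
    · rw [(H.add_def _ _).2 h]

/-- The hypergraph semigroup with the flat addition is an ai-semiring. -/
noncomputable instance : AiSemiring H.SG where
  add_assoc := H.sg_add_assoc
  add_comm := H.sg_add_comm
  mul_assoc := mul_assoc
  left_distrib := H.sg_mul_add
  right_distrib a b c := by
    rw [H.sg_mul_comm, sg_mul_add, H.sg_mul_comm a, H.sg_mul_comm b]
  add_self := H.sg_add_self

/-- The hypergraph semiring `S_ℍ`: the hypergraph semigroup with the flat addition. -/
noncomputable def semiring : AiSemiringAlg.{u} where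
  carrier := H.SG
  nonempty := ⟨H.zeroElt⟩

end ThreeHypergraph

/-! ### The triangle and the fans -/

/-- The triangle: six vertices `0, …, 5` and the three hyperedges `{0,1,2}`, `{2,3,4}`, `{4,5,0}`. -/
def triangle : ThreeHypergraph (Fin 6) where
  vertexSet := Set.univ
  edgeSet := {{0, 1, 2}, {2, 3, 4}, {4, 5, 0}}
  subset_vertexSet_of_mem_edgeSet' := fun _ _ => Set.subset_univ _
  finite := inferInstance
  vertexSet_eq := rfl
  uniform e he := by
    rcases he with rfl | rfl | rfl
    all_goals rw [Set.ncard_eq_three]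
    · exact ⟨0, 1, 2, by decide, by decide, by decide, rfl⟩
    · exact ⟨2, 3, 4, by decide, by decide, by decide, rfl⟩
    · exact ⟨4, 5, 0, by decide, by decide, by decide, rfl⟩
  linear e he f hf hne := by
    rcases he with rfl | rfl | rfl <;> rcases hf with rfl | rfl | rfl
    all_goals first
      | exact absurd rfl hne
      | (rintro x ⟨hx, hx'⟩ y ⟨hy, hy'⟩
         simp only [Set.mem_insert_iff, Set.mem_singleton_iff] at hx hx' hy hy'
         omega)
  no_isolated x h := by
    have h1 := h {0, 1, 2} (by simp)
    have h2 := h {2, 3, 4} (by simp)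
    have h3 := h {4, 5, 0} (by simp)
    simp only [Set.mem_insert_iff, Set.mem_singleton_iff] at h1 h2 h3
    omega

/-- The vertices of the `i`-th fan: the centre, the outer ends `0, …, i` of the `i + 1` spokes,
the middle vertices `0, …, i` of the spokes, and the middle vertices of the `i` rim hyperedges, each
of which joins the outer ends of two consecutive spokes. -/
inductive FanVertex (i : ℕ) : Type
  | center : FanVertex i
  | outer : Fin (i + 1) → FanVertex i
  | spokeMid : Fin (i + 1) → FanVertex i
  | rimMid : Fin i → FanVertex i

namespace FanVertex

variable {i : ℕ}

/-- The `j`-th spoke. -/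
def spoke (j : Fin (i + 1)) : Set (FanVertex i) := {center, spokeMid j, outer j}

/-- The `j`-th rim hyperedge, between the `j`-th and the `j + 1`-st spoke. -/
def rim (j : Fin i) : Set (FanVertex i) := {outer j.castSucc, rimMid j, outer j.succ}

instance : Finite (FanVertex i) := by
  have : Function.Surjective (fun s : Unit ⊕ Fin (i + 1) ⊕ Fin (i + 1) ⊕ Fin i =>
      match s with
      | .inl _ => center
      | .inr (.inl j) => outer j
      | .inr (.inr (.inl j)) => spokeMid j
      | .inr (.inr (.inr j)) => rimMid j) := by
    intro x
    cases x with
    | center => exact ⟨.inl (), rfl⟩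
    | outer j => exact ⟨.inr (.inl j), rfl⟩
    | spokeMid j => exact ⟨.inr (.inr (.inl j)), rfl⟩
    | rimMid j => exact ⟨.inr (.inr (.inr j)), rfl⟩
  exact Finite.of_surjective _ this

end FanVertex

open FanVertex in
/-- The `i`-th fan: `i` triangles with a common corner, the centre, such that consecutive triangles
share a spoke. It has the `2 i + 1` hyperedges `spoke j` (`0 ≤ j ≤ i`) and `rim j` (`0 ≤ j < i`). -/
def fan (i : ℕ) : ThreeHypergraph (FanVertex i) where
  vertexSet := Set.univ
  edgeSet := Set.range spoke ∪ Set.range rim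
  subset_vertexSet_of_mem_edgeSet' := fun _ _ => Set.subset_univ _
  finite := inferInstance
  vertexSet_eq := rfl
  uniform e he := by
    rw [Set.ncard_eq_three]
    rcases he with ⟨j, rfl⟩ | ⟨j, rfl⟩
    · exact ⟨_, _, _, by simp, by simp, by simp, rfl⟩
    · exact ⟨_, _, _, by simp, by simp [Fin.ext_iff], by simp, rfl⟩
  linear e he f hf hne := by
    rcases he with ⟨j, rfl⟩ | ⟨j, rfl⟩ <;> rcases hf with ⟨k, rfl⟩ | ⟨k, rfl⟩
    all_goals
      rintro x ⟨hx, hx'⟩ y ⟨hy, hy'⟩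
      simp only [spoke, rim, Set.mem_insert_iff, Set.mem_singleton_iff] at hx hx' hy hy'
      try have hjk : j ≠ k := fun h => hne (by rw [h])
      grind
  no_isolated x h := by
    cases x with
    | center => exact h (spoke 0) (.inl ⟨0, rfl⟩) (by simp [spoke])
    | outer j => exact h (spoke j) (.inl ⟨j, rfl⟩) (by simp [spoke])
    | spokeMid j => exact h (spoke j) (.inl ⟨j, rfl⟩) (by simp [spoke])
    | rimMid j => exact h (rim j) (.inr ⟨j, rfl⟩) (by simp [rim])

/-! The proof compares the two semirings through hypergraph homomorphisms. A homomorphism `H → G`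
acts on normal forms and preserves nonzero products, but it need not preserve vanishing ones.
Vanishing is recovered by using all homomorphisms at once. In the power of `S_G` indexed by them, a
nonzero element of `S_H` is represented by the tuple of its images, and every tuple with a zero
coordinate represents `0`. Tuples with a zero coordinate absorb under both operations. So this is a
homomorphism from a subalgebra of the power onto `S_H` as soon as distinct elements differ in some
coordinate and every vanishing product vanishes in some coordinate. By the shape of normal forms,
both follow once homomorphisms separate distinct vertices and send each pair outside all hyperedges
to another such pair (`generatedVariety_subset`).

For the triangle inside the fan, a single homomorphism suffices: the triangle is a retract of the
fan (`toTriangle_triangleToFan`). For the fan inside a power of the triangle, folding the fan by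
parity is not enough, since it identifies spokes of equal parity. The maps `FanVertex.toTriangle X`
flip the spokes indexed by a set `X` without consecutive elements onto the other hyperedge at the
corner `0`. Choosing `X` to contain at most two indices separates every pair of vertices
(`fanSeparated`). -/

/-! ### Varieties and homomorphisms given by graphs -/

/-- A variety that contains `A` contains every ai-semiring that is a homomorphic image of a
subalgebra of `A`, the homomorphism being given by its graph. -/
theorem IsVariety.mem_of_graph {K : Set AiSemiringAlg.{u}} (hK : IsVariety K)
    {A T : AiSemiringAlg.{u}} (hA : A ∈ K) (R : A.carrier → T.carrier → Prop)
    (hadd : ∀ {a s b t}, R a s → R b t → R (a + b) (s + t))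
    (hmul : ∀ {a s b t}, R a s → R b t → R (a * b) (s * t))
    (hfun : ∀ {a s t}, R a s → R a t → s = t) (hsurj : ∀ t, ∃ a, R a t) : T ∈ K := by
  let B : Type u := {a : A.carrier // ∃ s, R a s}
  let instAdd : Add B := ⟨fun a b => ⟨a.1 + b.1, a.2.choose + b.2.choose,
    hadd a.2.choose_spec b.2.choose_spec⟩⟩
  let instMul : Mul B := ⟨fun a b => ⟨a.1 * b.1, a.2.choose * b.2.choose,
    hmul a.2.choose_spec b.2.choose_spec⟩⟩
  let instB : AiSemiring B :=
    { instAdd, instMul with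
      add_assoc := fun a b c => Subtype.ext (add_assoc a.1 b.1 c.1)
      add_comm := fun a b => Subtype.ext (add_comm a.1 b.1)
      mul_assoc := fun a b c => Subtype.ext (mul_assoc a.1 b.1 c.1)
      left_distrib := fun a b c => Subtype.ext (left_distrib a.1 b.1 c.1)
      right_distrib := fun a b c => Subtype.ext (right_distrib a.1 b.1 c.1)
      add_self := fun a => Subtype.ext (AiSemiring.add_self a.1) }
  have hne : Nonempty B :=
    let ⟨t⟩ := T.nonempty
    ⟨⟨(hsurj t).choose, t, (hsurj t).choose_spec⟩⟩
  have hB : (⟨B⟩ : AiSemiringAlg.{u}) ∈ K :=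
    hK.sub A hA ⟨B⟩ Subtype.val ⟨fun _ _ => rfl, fun _ _ => rfl⟩ Subtype.val_injective
  -- Single-valuedness of `R` identifies the chosen value with any other related one, so the choice
  -- respects the operations.
  refine hK.image ⟨B⟩ hB T (fun a => a.2.choose) ⟨fun a b => ?_, fun a b => ?_⟩ fun t => ?_
  · exact hfun (a + b).2.choose_spec (hadd a.2.choose_spec b.2.choose_spec)
  · exact hfun (a * b).2.choose_spec (hmul a.2.choose_spec b.2.choose_spec)
  · obtain ⟨a, ha⟩ := hsurj t
    exact ⟨⟨a, t, ha⟩, hfun (Exists.choose_spec (⟨t, ha⟩ : ∃ s, R a s)) ha⟩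

/-- Provides a copy of a semiring in the larger universe in which the varieties are formed. -/
instance ULift.instAiSemiring {S : Type v} [AiSemiring S] : AiSemiring (ULift.{u} S) where
  add_assoc a b c := congrArg ULift.up (add_assoc a.down b.down c.down)
  add_comm a b := congrArg ULift.up (add_comm a.down b.down)
  mul_assoc a b c := congrArg ULift.up (mul_assoc a.down b.down c.down)
  left_distrib a b c := congrArg ULift.up (left_distrib a.down b.down c.down)
  right_distrib a b c := congrArg ULift.up (right_distrib a.down b.down c.down)
  add_self a := congrArg ULift.up (AiSemiring.add_self a.down)

/-! ### Normal forms under hypergraph homomorphisms -/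

namespace ThreeHypergraph

theorem nf_mul_def {V : Type u} (H : ThreeHypergraph V) (a b : H.NF) : a * b = H.nfMul a b := rfl

theorem toNF_eq_zero_iff {V : Type u} (H : ThreeHypergraph V) {a : H.SG} :
    H.toNF a = .zero ↔ a = H.zeroElt :=
  ⟨fun h => H.toNF_injective h, fun h => h ▸ rfl⟩

theorem exists_edge {V : Type u} (H : ThreeHypergraph V) (x : V) :
    ∃ y z, {y, z, x} ∈ H.edgeSet := by
  obtain ⟨y, z, h, -⟩ := H.ofNF_two_cases x
  exact ⟨y, z, h⟩

/-- A vertex is needed because `ofNF` sends `top` to the default value `0` when there is no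
hyperedge. -/
theorem toNF_ofNF {V : Type u} (H : ThreeHypergraph V) [Nonempty V] (a : H.NF) :
    H.toNF (H.ofNF a) = a := by
  cases a with
  | zero => rfl
  | one x => rfl
  | two w =>
    obtain ⟨x, y, h⟩ := H.exists_edge w
    rw [H.ofNF_two h, map_mul]
    exact H.nfMul_one_one h
  | top =>
    obtain ⟨x, y, h⟩ := H.exists_edge (Classical.arbitrary V)
    rw [H.ofNF_top h, map_mul, map_mul]
    exact (H.nfMul_three _ _ _).trans (if_pos h)

/-- Hypergraph homomorphisms: maps that send hyperedges to hyperedges. -/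
def IsHom {V W : Type u} (H : ThreeHypergraph V) (G : ThreeHypergraph W) (φ : V → W) : Prop :=
  ∀ x y z, {x, y, z} ∈ H.edgeSet → {φ x, φ y, φ z} ∈ G.edgeSet

/-- The map on normal forms induced by a map on vertices. -/
def NF.map {V W : Type u} {H : ThreeHypergraph V} (G : ThreeHypergraph W) (φ : V → W) :
    H.NF → G.NF
  | .zero => .zero
  | .one x => .one (φ x)
  | .two x => .two (φ x)
  | .top => .top

section Separation

variable {V W : Type u} {H : ThreeHypergraph V} {G : ThreeHypergraph W}

theorem NF.map_eq_zero_iff (φ : V → W) {a : H.NF} : a.map G φ = .zero ↔ a = .zero := by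
  cases a <;> simp [NF.map]

/-- If homomorphisms separate the vertices, then they separate the nonzero normal forms. -/
theorem NF.exists_map_ne [Nonempty V]
    (hpt : ∀ x y, x ≠ y → ∃ φ, H.IsHom G φ ∧ φ x ≠ φ y)
    (hex : ∃ φ, H.IsHom G φ) {a b : H.NF} (hab : a ≠ b) :
    ∃ φ, H.IsHom G φ ∧ a.map G φ ≠ b.map G φ := by
  obtain ⟨ψ, hψ⟩ := hex
  cases a <;> cases b
  case one.one x y =>
    obtain ⟨φ, hφ, h⟩ := hpt x y (by rintro rfl; exact hab rfl)
    exact ⟨φ, hφ, by simpa [NF.map] using h⟩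
  case two.two x y =>
    obtain ⟨φ, hφ, h⟩ := hpt x y (by rintro rfl; exact hab rfl)
    exact ⟨φ, hφ, by simpa [NF.map] using h⟩
  -- Normal forms of different shapes keep their shapes, so any homomorphism separates them.
  all_goals first
    | exact absurd rfl hab
    | exact ⟨ψ, hψ, by simp [NF.map]⟩

/-- Homomorphisms preserve the nonzero products of normal forms. -/
theorem NF.map_mul_of_ne_zero {φ : V → W} (hφ : H.IsHom G φ) {a b : H.NF}
    (h : a * b ≠ .zero) : (a * b).map G φ = a.map G φ * b.map G φ := by
  simp only [nf_mul_def] at h ⊢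
  cases a <;> cases b <;> try exact absurd rfl h
  case one.one x y =>
    by_cases he : ∃ w, ({x, y, w} : Set V) ∈ H.edgeSet
    · obtain ⟨w, he⟩ := he
      rw [H.nfMul_one_one he]
      exact (G.nfMul_one_one (hφ _ _ _ he)).symm
    · exact absurd (H.nfMul_one_one_zero he) h
  case one.two x w =>
    by_cases hx : x = w
    · simp [hx, nfMul, NF.map]
    · simp [nfMul, hx] at h
  case two.one w x =>
    by_cases hx : x = w
    · simp [hx, nfMul, NF.map]
    · simp [nfMul, hx] at h

/-- If homomorphisms separate the vertices and the pairs that are not subhyperedges, then every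
vanishing product of normal forms vanishes under one of them. -/
theorem NF.exists_map_mul_eq_zero
    (hpt : ∀ x y, x ≠ y → ∃ φ, H.IsHom G φ ∧ φ x ≠ φ y)
    (hpair : ∀ x y, (¬ ∃ w, {x, y, w} ∈ H.edgeSet) →
      ∃ φ, H.IsHom G φ ∧ ¬ ∃ w, {φ x, φ y, w} ∈ G.edgeSet)
    (hex : ∃ φ, H.IsHom G φ) {a b : H.NF} (h : a * b = .zero) :
    ∃ φ, H.IsHom G φ ∧ a.map G φ * b.map G φ = .zero := by
  obtain ⟨ψ, hψ⟩ := hex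
  simp only [nf_mul_def] at h ⊢
  -- The products removed here vanish in every hypergraph, by shape alone.
  cases a <;> cases b <;> try exact ⟨ψ, hψ, rfl⟩
  case one.one x y =>
    by_cases he : ∃ w, ({x, y, w} : Set V) ∈ H.edgeSet
    · obtain ⟨w, he⟩ := he
      simp [H.nfMul_one_one he] at h
    · obtain ⟨φ, hφ, hn⟩ := hpair x y he
      exact ⟨φ, hφ, G.nfMul_one_one_zero hn⟩
  case one.two x w =>
    -- `two w` is annihilated by every vertex except `w`, so it is enough to keep `x` and `w` apart.
    have hx : x ≠ w := by rintro rfl; simp [nfMul] at h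
    obtain ⟨φ, hφ, hn⟩ := hpt x w hx
    exact ⟨φ, hφ, by simp [nfMul, NF.map, hn]⟩
  case two.one w x =>
    have hx : x ≠ w := by rintro rfl; simp [nfMul] at h
    obtain ⟨φ, hφ, hn⟩ := hpt x w hx
    exact ⟨φ, hφ, by simp [nfMul, NF.map, hn]⟩

end Separation

/-! ### From separating homomorphisms to inclusion of varieties -/

/-- If the homomorphisms `H → G` separate the vertices of `H` and the pairs of vertices that are not
subhyperedges, then `S_H` lies in the variety generated by `S_G`: it is a homomorphic image of a
subalgebra of a power of `S_G`, under a map sending all tuples with a zero coordinate to `0`. -/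
theorem generatedVariety_subset {V W : Type v} [Nonempty V] [Nonempty W]
    (H : ThreeHypergraph V) (G : ThreeHypergraph W)
    (hpt : ∀ x y, x ≠ y → ∃ φ, H.IsHom G φ ∧ φ x ≠ φ y)
    (hpair : ∀ x y, (¬ ∃ w, {x, y, w} ∈ H.edgeSet) →
      ∃ φ, H.IsHom G φ ∧ ¬ ∃ w, {φ x, φ y, w} ∈ G.edgeSet) :
    generatedVariety.{u, v} H.semiring ⊆ generatedVariety.{u, v} G.semiring := by
  intro T hT K hK hG
  refine hT K hK fun S ⟨f, ⟨hfadd, hfmul⟩, hf⟩ => ?_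
  have hex : ∃ φ, H.IsHom G φ := by
    obtain ⟨x⟩ := ‹Nonempty V›
    -- The degenerate pair `x, x` has no completion, since hyperedges have three distinct vertices.
    obtain ⟨φ, hφ, -⟩ := hpair x x fun ⟨w, hw⟩ => (H.edge_distinct hw).1 rfl
    exact ⟨φ, hφ⟩
  let I : Type (max u v) := ULift.{u} {φ : V → W // H.IsHom G φ}
  let C : AiSemiringAlg.{max u v} :=
    { carrier := ULift.{u} G.SG, nonempty := ⟨⟨G.zeroElt⟩⟩ }
  have hC : C ∈ K := hG C ⟨fun a => a.down, ⟨fun _ _ => rfl, fun _ _ => rfl⟩,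
    ULift.down_injective, ULift.down_surjective⟩
  -- The domain of `R` omits tuples that have no zero coordinate and do not come from one element of
  -- `S_H`.
  let R : (I → ULift.{u} G.SG) → H.SG → Prop := fun p s =>
    (s = H.zeroElt ∧ ∃ φ, (p φ).down = G.zeroElt) ∨
      (s ≠ H.zeroElt ∧ ∀ φ, G.toNF (p φ).down = (H.toNF s).map G φ.down.1)
  have hRadd : ∀ {p s q t}, R p s → R q t → R (p + q) (s + t) := by
    rintro p s q t (⟨rfl, φ, hp⟩ | ⟨hs, hp⟩) hq
    · refine .inl ⟨(H.sg_add_comm _ _).trans (H.sg_add_zero _), φ, ?_⟩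
      change (p φ).down + (q φ).down = _
      rw [hp, sg_add_comm, sg_add_zero]
    rcases hq with ⟨rfl, φ, hq⟩ | ⟨ht, hq⟩
    · refine .inl ⟨H.sg_add_zero _, φ, ?_⟩
      change (p φ).down + (q φ).down = _
      rw [hq, sg_add_zero]
    by_cases hst : s = t
    · subst hst
      refine .inr ⟨by rwa [sg_add_self], fun φ => ?_⟩
      change G.toNF ((p φ).down + (q φ).down) = _
      rw [G.toNF_injective ((hp φ).trans (hq φ).symm), sg_add_self, sg_add_self, hq]
    -- In flat addition, one coordinate where the summands differ already gives a zero coordinate of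
    -- the sum.
    · obtain ⟨φ, hφ, hne⟩ := NF.exists_map_ne hpt hex fun h => hst (H.toNF_injective h)
      refine .inl ⟨(H.add_def _ _).2 hst, ⟨⟨φ, hφ⟩⟩, (G.add_def _ _).2 fun h => hne ?_⟩
      exact (hp ⟨φ, hφ⟩).symm.trans ((congrArg G.toNF h).trans (hq ⟨φ, hφ⟩))
  have hRmul : ∀ {p s q t}, R p s → R q t → R (p * q) (s * t) := by
    rintro p s q t (⟨rfl, φ, hp⟩ | ⟨hs, hp⟩) hq
    · refine .inl ⟨H.sg_zero_mul _, φ, ?_⟩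
      change (p φ).down * (q φ).down = _
      rw [hp, sg_zero_mul]
    rcases hq with ⟨rfl, φ, hq⟩ | ⟨ht, hq⟩
    · refine .inl ⟨H.sg_mul_zero _, φ, ?_⟩
      change (p φ).down * (q φ).down = _
      rw [hq, sg_mul_zero]
    by_cases hst : s * t = H.zeroElt
    · obtain ⟨φ, hφ, h0⟩ := NF.exists_map_mul_eq_zero hpt hpair hex
        ((map_mul H.toNF s t).symm.trans (H.toNF_eq_zero_iff.2 hst))
      refine .inl ⟨hst, ⟨⟨φ, hφ⟩⟩, G.toNF_eq_zero_iff.1 ?_⟩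
      rw [← h0, ← hp ⟨φ, hφ⟩, ← hq ⟨φ, hφ⟩, ← map_mul]
      rfl
    · refine .inr ⟨hst, fun φ => ?_⟩
      rw [map_mul, NF.map_mul_of_ne_zero φ.down.2, ← hp, ← hq, ← map_mul]
      · rfl
      · rwa [← map_mul, Ne, toNF_eq_zero_iff]
  have hRfun : ∀ {p s t}, R p s → R p t → s = t := by
    have hne : ∀ {p : I → ULift.{u} G.SG} {s}, s ≠ H.zeroElt → (∀ φ : I, G.toNF (p φ).down = (H.toNF s).map G φ.down.1) →
        ∀ φ : I, (p φ).down ≠ G.zeroElt := fun hs hp φ h0 =>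
      hs (H.toNF_eq_zero_iff.1 ((NF.map_eq_zero_iff φ.down.1).1
        ((hp φ).symm.trans (G.toNF_eq_zero_iff.2 h0))))
    rintro p s t (⟨rfl, φ, hp⟩ | ⟨hs, hp⟩) (⟨rfl, ψ, hq⟩ | ⟨ht, hq⟩)
    · rfl
    · exact absurd hp (hne ht hq φ)
    · exact absurd hq (hne hs hp ψ)
    · by_contra hst
      obtain ⟨φ, hφ, h⟩ := NF.exists_map_ne hpt hex fun h => hst (H.toNF_injective h)
      exact h ((hp ⟨φ, hφ⟩).symm.trans (hq ⟨φ, hφ⟩))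
  have hRsurj : ∀ s, ∃ p, R p s := fun s => by
    by_cases hs : s = H.zeroElt
    -- The zero tuple has a zero coordinate only because the index set is nonempty.
    · obtain ⟨φ, hφ⟩ := hex
      exact ⟨fun _ => ⟨G.zeroElt⟩, .inl ⟨hs, ⟨⟨φ, hφ⟩⟩, rfl⟩⟩
    · exact ⟨fun φ => ⟨G.ofNF ((H.toNF s).map G φ.down.1)⟩, .inr ⟨hs, fun φ => G.toNF_ofNF _⟩⟩
  refine hK.mem_of_graph (hK.prod I (fun _ => C) fun _ => hC) (fun p s => R p (f s))
    ?_ ?_ ?_ fun s => hRsurj (f s)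
  · intro p s q t hp hq
    rw [hfadd]
    exact hRadd hp hq
  · intro p s q t hp hq
    rw [hfmul]
    exact hRmul hp hq
  · intro p s t hp hq
    exact hf.1 (hRfun hp hq)

end ThreeHypergraph

/-! ### Separated pairs in the triangle -/

/-- Turns hyperedge membership into a statement about finite sets that `decide` can settle. -/
theorem triangle_edge_iff (x y z : Fin 6) : {x, y, z} ∈ triangle.edgeSet ↔
    ({x, y, z} : Finset (Fin 6)) ∈ ({{0, 1, 2}, {2, 3, 4}, {4, 5, 0}} : Finset (Finset (Fin 6))) := by
  change ({x, y, z} : Set (Fin 6)) = {0, 1, 2} ∨ ({x, y, z} : Set (Fin 6)) = {2, 3, 4} ∨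
    ({x, y, z} : Set (Fin 6)) = {4, 5, 0} ↔ _
  simp only [Finset.mem_insert, Finset.mem_singleton, ← Finset.coe_inj, Finset.coe_insert,
    Finset.coe_singleton]

/-- Two distinct vertices of the triangle that lie in no common hyperedge. -/
def TriangleSeparated (a b : Fin 6) : Prop :=
  a ≠ b ∧ ∀ w : Fin 6, ({a, b, w} : Finset (Fin 6)) ∉
    ({{0, 1, 2}, {2, 3, 4}, {4, 5, 0}} : Finset (Finset (Fin 6)))

instance : DecidableRel TriangleSeparated := fun _ _ => inferInstanceAs (Decidable (_ ∧ _))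

theorem TriangleSeparated.symm {a b : Fin 6} (h : TriangleSeparated a b) :
    TriangleSeparated b a :=
  ⟨h.1.symm, fun w => Finset.insert_comm a b {w} ▸ h.2 w⟩

theorem TriangleSeparated.not_subedge {a b : Fin 6} (h : TriangleSeparated a b) :
    ¬ ∃ w, {a, b, w} ∈ triangle.edgeSet :=
  fun ⟨w, hw⟩ => h.2 w ((triangle_edge_iff a b w).1 hw)

/-! ### Folding the fan onto the triangle -/

namespace FanVertex

variable {i : ℕ}

open Classical in
/-- The map from the fan to the triangle that belongs to a set `X` of natural numbers. The centre
goes to the corner `0`, the outer ends with index outside `X` go to the other two corners,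
alternating with the parity of the index, and those with index in `X` go to the middle vertices of
the two hyperedges at the corner `0`. -/
noncomputable def toTriangle (X : Set ℕ) : FanVertex i → Fin 6
  | center => 0
  | outer j => if j.1 ∈ X then (if Even j.1 then 5 else 1) else (if Even j.1 then 2 else 4)
  | spokeMid j => if j.1 ∈ X then (if Even j.1 then 4 else 2) else (if Even j.1 then 1 else 5)
  | rimMid j => if j.1 ∈ X ∨ j.1 + 1 ∈ X then 0 else 3

end FanVertex

/-- A map that sends some ordering of every spoke and of every rim hyperedge to a hyperedge is a
homomorphism. -/
theorem fan_isHom {i : ℕ} {W : Type} {G : ThreeHypergraph W} {φ : FanVertex i → W}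
    (hs : ∀ j, {φ .center, φ (.spokeMid j), φ (.outer j)} ∈ G.edgeSet)
    (hr : ∀ j : Fin i, {φ (.outer j.castSucc), φ (.rimMid j), φ (.outer j.succ)} ∈ G.edgeSet) :
    (fan i).IsHom G φ := by
  intro x y z h
  -- A hyperedge is an unordered set, so passing to images avoids a case for every ordering of its
  -- vertices.
  have himage : ({φ x, φ y, φ z} : Set W) = φ '' {x, y, z} := by
    simp only [Set.image_insert_eq, Set.image_singleton]
  rw [himage]
  rcases h with ⟨j, hj⟩ | ⟨j, hj⟩
  · rw [← hj]
    simpa only [FanVertex.spoke, Set.image_insert_eq, Set.image_singleton] using hs j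
  · rw [← hj]
    simpa only [FanVertex.rim, Set.image_insert_eq, Set.image_singleton] using hr j

/-- A rim between two unflipped spokes goes to `{2, 3, 4}`. If one spoke is flipped, both spokes lie
over the same hyperedge at `0`, and the rim is folded onto it. Two consecutive flips would put the
outer ends at `5` and `1`, which share no hyperedge. -/
theorem toTriangle_isHom {i : ℕ} {X : Set ℕ} (hX : ∀ j ∈ X, j + 1 ∉ X) :
    (fan i).IsHom triangle (FanVertex.toTriangle X) := by
  refine fan_isHom (fun j => ?_) fun j => ?_
  · rw [triangle_edge_iff]
    simp only [FanVertex.toTriangle]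
    split_ifs <;> decide
  · rw [triangle_edge_iff]
    simp only [FanVertex.toTriangle, Fin.val_castSucc, Fin.val_succ, Nat.even_add_one]
    have := hX j.1
    by_cases h1 : j.1 ∈ X <;> by_cases h2 : j.1 + 1 ∈ X <;> by_cases h3 : Even j.1 <;>
      simp only [h1, h2, h3, if_true, if_false, or_true, true_or, or_self, not_true, not_false_eq_true] <;>
      first
        | exact absurd h2 (this h1)
        | decide

theorem fan_spoke_mem {i : ℕ} (j : Fin (i + 1)) :
    {.center, .spokeMid j, .outer j} ∈ (fan i).edgeSet :=
  .inl ⟨j, rfl⟩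

theorem fan_rim_mem {i : ℕ} {j : Fin i} {k l : Fin (i + 1)} (hk : k.1 = j.1) (hl : l.1 = j.1 + 1) :
    {.outer k, .rimMid j, .outer l} ∈ (fan i).edgeSet := by
  obtain rfl : k = j.castSucc := Fin.ext hk
  obtain rfl : l = j.succ := Fin.ext hl
  exact .inr ⟨j, rfl⟩

/-! ### Separating the vertices of the fan -/

/-- Two vertices of the fan lie in a common hyperedge or are mapped by some homomorphism to two
separated vertices of the triangle. -/
def FanSeparated {i : ℕ} (x y : FanVertex i) : Prop :=
  (∃ w, {x, y, w} ∈ (fan i).edgeSet) ∨ ∃ X : Set ℕ, (∀ j ∈ X, j + 1 ∉ X) ∧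
    TriangleSeparated (FanVertex.toTriangle X x) (FanVertex.toTriangle X y)

namespace FanSeparated

variable {i : ℕ}

theorem symm {x y : FanVertex i} (h : FanSeparated x y) : FanSeparated y x := by
  rcases h with ⟨w, h⟩ | ⟨X, hX, h⟩
  · exact .inl ⟨w, (fan i).edge_swap.1 h⟩
  · exact .inr ⟨X, hX, h.symm⟩

theorem center_outer (j : Fin (i + 1)) : FanSeparated .center (.outer j) :=
  .inl ⟨_, (fan i).edge_swap.1 ((fan i).edge_rot.1 ((fan i).edge_rot.1 (fan_spoke_mem j)))⟩

theorem center_spokeMid (j : Fin (i + 1)) : FanSeparated .center (.spokeMid j) :=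
  .inl ⟨_, fan_spoke_mem j⟩

theorem center_rimMid (j : Fin i) : FanSeparated .center (.rimMid j) := by
  refine .inr ⟨∅, by simp, ?_⟩
  simp only [FanVertex.toTriangle, Set.mem_empty_iff_false, or_self, if_false]
  decide

theorem outer_outer_of_lt {j k : Fin (i + 1)} (h : j < k) :
    FanSeparated (.outer j) (.outer k) := by
  by_cases hjk : k.1 = j.1 + 1
  · exact .inl ⟨_, (fan i).edge_swap.1 ((fan i).edge_rot.1 ((fan i).edge_rot.1
      (fan_rim_mem (j := ⟨j, by omega⟩) rfl hjk)))⟩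
  · by_cases hp : Even j.1 ↔ Even k.1
    -- With equal parity, flipping only spoke `j` gives the pair `5, 2` or `1, 4`.
    · refine .inr ⟨{j.1}, by simp, ?_⟩
      have hne : k.1 ≠ j.1 := by omega
      simp only [FanVertex.toTriangle, Set.mem_singleton_iff, if_true, hne, if_false, hp]
      split_ifs <;> decide
    -- With opposite parity both spokes are flipped, giving `5` and `1`; this is allowed because the
    -- indices are not consecutive.
    · refine .inr ⟨{j.1, k.1}, by simp; omega, ?_⟩
      simp only [FanVertex.toTriangle, Set.mem_insert_iff, Set.mem_singleton_iff, true_or, or_true,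
        if_true]
      split_ifs <;> first | decide | (exfalso; tauto)

theorem outer_spokeMid (j k : Fin (i + 1)) : FanSeparated (.outer j) (.spokeMid k) := by
  by_cases hjk : j = k
  · subst hjk
    exact .inl ⟨_, (fan i).edge_swap.1 ((fan i).edge_rot.1 (fan_spoke_mem j))⟩
  have hne : k.1 ≠ j.1 := by omega
  by_cases hp : Even j.1 ↔ Even k.1
  · refine .inr ⟨{j.1}, by simp, ?_⟩
    simp only [FanVertex.toTriangle, Set.mem_singleton_iff, if_true, hne, if_false, hp]
    split_ifs <;> decide
  · refine .inr ⟨∅, by simp, ?_⟩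
    simp only [FanVertex.toTriangle, Set.mem_empty_iff_false, if_false]
    split_ifs <;> first | decide | (exfalso; tauto)

theorem outer_rimMid (j : Fin (i + 1)) (k : Fin i) : FanSeparated (.outer j) (.rimMid k) := by
  by_cases h1 : j.1 = k.1
  · exact .inl ⟨_, fan_rim_mem (l := k.succ) h1 rfl⟩
  by_cases h2 : j.1 = k.1 + 1
  · exact .inl ⟨_, (fan i).edge_swap.1 ((fan i).edge_rot.1 (fan_rim_mem (k := k.castSucc) rfl h2))⟩
  -- The rim does not touch spoke `j`, so its middle stays at `3` while the outer end moves to `5`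
  -- or `1`.
  refine .inr ⟨{j.1}, by simp, ?_⟩
  simp only [FanVertex.toTriangle, Set.mem_singleton_iff, if_true, Ne.symm h1, Ne.symm h2, or_self,
    if_false]
  split_ifs <;> decide

theorem spokeMid_spokeMid {j k : Fin (i + 1)} (h : j ≠ k) :
    FanSeparated (.spokeMid j) (.spokeMid k) := by
  have hne : k.1 ≠ j.1 := by omega
  by_cases hp : Even j.1 ↔ Even k.1
  · refine .inr ⟨{j.1}, by simp, ?_⟩
    simp only [FanVertex.toTriangle, Set.mem_singleton_iff, if_true, hne, if_false, hp]
    split_ifs <;> decide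
  · refine .inr ⟨∅, by simp, ?_⟩
    simp only [FanVertex.toTriangle, Set.mem_empty_iff_false, if_false]
    split_ifs <;> first | decide | (exfalso; tauto)

theorem spokeMid_rimMid (j : Fin (i + 1)) (k : Fin i) :
    FanSeparated (.spokeMid j) (.rimMid k) := by
  refine .inr ⟨∅, by simp, ?_⟩
  simp only [FanVertex.toTriangle, Set.mem_empty_iff_false, or_self, if_false]
  split_ifs <;> decide

theorem rimMid_rimMid_of_lt {j k : Fin i} (h : j < k) :
    FanSeparated (.rimMid j) (.rimMid k) := by
  -- Flipping spoke `j` moves the middles of rims `j - 1` and `j` to `0`. As `j < k`, the middle of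
  -- rim `k` stays at `3`.
  refine .inr ⟨{j.1}, by simp, ?_⟩
  have h1 : k.1 ≠ j.1 := by omega
  have h2 : k.1 + 1 ≠ j.1 := by omega
  simp only [FanVertex.toTriangle, Set.mem_singleton_iff, true_or, if_true, h1, h2, or_self,
    if_false]
  decide

end FanSeparated

theorem fanSeparated {i : ℕ} {x y : FanVertex i} (h : x ≠ y) : FanSeparated x y := by
  open FanSeparated in
  cases x with
  | center =>
    cases y with
    | center => exact absurd rfl h
    | outer k => exact center_outer k
    | spokeMid k => exact center_spokeMid k
    | rimMid k => exact center_rimMid k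
  | outer j =>
    cases y with
    | center => exact (center_outer j).symm
    | outer k =>
      rcases lt_or_gt_of_ne (show j ≠ k by rintro rfl; exact h rfl) with hjk | hjk
      · exact outer_outer_of_lt hjk
      · exact (outer_outer_of_lt hjk).symm
    | spokeMid k => exact outer_spokeMid j k
    | rimMid k => exact outer_rimMid j k
  | spokeMid j =>
    cases y with
    | center => exact (center_spokeMid j).symm
    | outer k => exact (outer_spokeMid k j).symm
    | spokeMid k => exact spokeMid_spokeMid (by rintro rfl; exact h rfl)
    | rimMid k => exact spokeMid_rimMid j k
  | rimMid j =>
    cases y with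
    | center => exact (center_rimMid j).symm
    | outer k => exact (outer_rimMid k j).symm
    | spokeMid k => exact (spokeMid_rimMid k j).symm
    | rimMid k =>
      rcases lt_or_gt_of_ne (show j ≠ k by rintro rfl; exact h rfl) with hjk | hjk
      · exact rimMid_rimMid_of_lt hjk
      · exact (rimMid_rimMid_of_lt hjk).symm

instance {i : ℕ} : Nonempty (FanVertex i) := ⟨.center⟩

theorem generatedVariety_fan_subset (i : ℕ) :
    generatedVariety.{u, 0} (fan i).semiring ⊆ generatedVariety.{u, 0} triangle.semiring := by
  refine ThreeHypergraph.generatedVariety_subset _ _ (fun x y hxy => ?_) fun x y hxy => ?_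
  · rcases fanSeparated hxy with ⟨w, hw⟩ | ⟨X, hX, h⟩
    -- Vertices in a common hyperedge are separated by every homomorphism, because the image is
    -- again a hyperedge with three distinct vertices.
    · have h0 := toTriangle_isHom (i := i) (X := ∅) (by simp)
      exact ⟨_, h0, (triangle.edge_distinct (h0 _ _ _ hw)).1⟩
    · exact ⟨_, toTriangle_isHom hX, h.1⟩
  · by_cases h : x = y
    · subst h
      exact ⟨_, toTriangle_isHom (X := ∅) (by simp), fun ⟨w, hw⟩ =>
        (triangle.edge_distinct hw).1 rfl⟩
    · rcases fanSeparated h with hw | ⟨X, hX, h⟩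
      · exact absurd hw hxy
      · exact ⟨_, toTriangle_isHom hX, h.not_subedge⟩

/-! ### The triangle as a retract of the fan -/

/-- The embedding of the triangle into the fan as the triangle of its first two spokes. -/
def triangleToFan (i : ℕ) (hi : 1 ≤ i) : Fin 6 → FanVertex i :=
  ![.center, .spokeMid 0, .outer 0, .rimMid ⟨0, hi⟩, .outer ⟨1, by omega⟩, .spokeMid ⟨1, by omega⟩]

theorem triangleToFan_isHom (i : ℕ) (hi : 1 ≤ i) : triangle.IsHom (fan i) (triangleToFan i hi) := by
  intro x y z h
  have himage : ({triangleToFan i hi x, triangleToFan i hi y, triangleToFan i hi z} :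
      Set (FanVertex i)) = triangleToFan i hi '' {x, y, z} := by
    simp only [Set.image_insert_eq, Set.image_singleton]
  rw [himage]
  rcases h with h | h | h <;> rw [h] <;> simp only [Set.image_insert_eq, Set.image_singleton]
  · exact fan_spoke_mem 0
  · exact fan_rim_mem (j := ⟨0, hi⟩) rfl rfl
  · exact (fan i).edge_swap.1 ((fan i).edge_rot.1 (fan_spoke_mem _))

/-- The retraction makes the embedding injective, and it carries a completion of a pair in the fan
back to one in the triangle; these are the two separation conditions. -/
theorem toTriangle_triangleToFan (i : ℕ) (hi : 1 ≤ i) (x : Fin 6) :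
    FanVertex.toTriangle ∅ (triangleToFan i hi x) = x := by
  fin_cases x <;> simp [triangleToFan, FanVertex.toTriangle]

theorem generatedVariety_triangle_subset (i : ℕ) (hi : 1 ≤ i) :
    generatedVariety.{u, 0} triangle.semiring ⊆ generatedVariety.{u, 0} (fan i).semiring := by
  refine ThreeHypergraph.generatedVariety_subset _ _
    (fun x y hxy => ⟨_, triangleToFan_isHom i hi, fun h => hxy ?_⟩)
    fun x y hxy => ⟨_, triangleToFan_isHom i hi, fun ⟨w, hw⟩ => hxy ⟨FanVertex.toTriangle ∅ w, ?_⟩⟩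
  · rw [← toTriangle_triangleToFan i hi x, h, toTriangle_triangleToFan]
  · have := toTriangle_isHom (X := ∅) (by simp) _ _ _ hw
    rwa [toTriangle_triangleToFan, toTriangle_triangleToFan] at this

theorem proposition4p4 (i : ℕ) (hi : 1 ≤ i) :
    generatedVariety.{u, 0} (fan i).semiring = generatedVariety.{u, 0} triangle.semiring :=
  (generatedVariety_fan_subset i).antisymm (generatedVariety_triangle_subset i hi)
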